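/- **Setting.** Let $n\ge 10$, $U\ge 2$, $\epsilon\in(0,1)$. Let $L\in\mathbb Z^{n\times n}$ be an SDDM matrix (invertible, symmetric, $L_{ij}\le 0$ for $i\ne j$, $L_{ii}>0$, and $|L_{ii}|\ge\sum_{j\neq i}|L_{ij}|$) with entries in $[-U,U]$ that is irreducible (the graph on $[n]$ of its nonzero off-diagonal entries is connected), and let $b\in\mathbb Z^n$ have entries in $[0,U]$. Put $D_L(i,j)=-\log_{nU}\big((L^{-1})_{ij}\big)+2$, $\ell=\lceil\sqrt{\log_2 n}\rceil+3$, $r_{\rm in}=2^{2\ell+1}$, $r_{\rm out}=2^{\ell-2}$. An $(r_{\rm in},r_{\rm out},\alpha)$-cover for $L$ is a finite set $\mathcal C$ of pairs $(V,W)$ with $V\subseteq W\subseteq[n]$ such that every $u\in[n]$ lies in some $V$ and in at most $\alpha$ of the sets $W$, $D_L(u,v)\le r_{\rm in}$ for all $u,v\in W$, and $D_L(u,v)>r_{\rm out}$ for all $u\in V$, $v\in[n]\setminus W$. For $I\subseteq[n]$ let $\mathsf{Exp}_{\mathcal C}(I)$ be the union of the $V$ with $(V,W)\in\mathcal C$ and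 $W\cap I\ne\emptyset$. For vectors, $x\approx_\eta y$ means $e^{-\eta}y_i\le x_i\le e^{\eta}y_i$ for all indices $i$. **The algorithm SDDMSolve** first produces an $(r_{\rm in},r_{\rm out},\alpha)$-cover $\mathcal C$ for $L$. Let $T=n$, $\epsilon_L=\epsilon/(64T(nU)^2)$, $S^{(0)}=[n]$, $\hat b^{(0)}=b$, and let $\tilde x^{(0)}$ be the empty vector. For $t=0,\dots,T$: 1. Let $I^{(t)}=\{u\in S^{(t)}:\hat b^{(t)}_u>0\}$, $H=H^{(t)}=\mathsf{Exp}_{\mathcal C}(I^{(t)})\cap S^{(t)}$ and $Z=\|\hat b^{(t)}_H\|_1$. A normwise solver returns $y$ with $\|y-(L_{H,H})^{-1}(\hat b^{(t)}_H/Z)\|_2\le\frac{\epsilon_L}{2}\|\hat b^{(t)}_H/Z\|_2$ (if $Z=0$, the right-hand side $\hat b^{(t)}_H/Z$ is read as $0$). Set $\hat x^{(t)}_H=Zy$ and $\hat x^{(t)}_{S^{(t)}\setminus H}=0$. 2. Let $\theta_t$ be the smallest power of two larger than $\frac1{4(nU)^2}\|\hat b^{(t)}\|_1$ (any power of two if $\hat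 b^{(t)}=0$), $F^{(t)}=\{i\in S^{(t)}:\hat x^{(t)}_i\ge\theta_t\}$ and $S^{(t+1)}=S^{(t)}\setminus F^{(t)}$. Let $\tilde x^{(t+1)}$, on $[n]\setminus S^{(t+1)}$, extend $\tilde x^{(t)}$ by $\hat x^{(t)}_{F^{(t)}}$. 3. Compute $\hat b^{(t+1)}$ on $S^{(t+1)}$ with $\hat b^{(t+1)}\approx_{\epsilon/(8T)} b_{S^{(t+1)}}-L_{S^{(t+1)},[n]\setminus S^{(t+1)}}\tilde x^{(t+1)}$. **Lemma.** In every run of SDDMSolve (in which the set $\mathcal C$ produced is such a cover and the normwise solver always meets its accuracy guarantee), every $u\in[n]$ satisfies $$\sum_{t=0}^{T}\mathbf 1[u\in H^{(t)}]\le r_{\rm in}.$$ Hence $\sum_{t=0}^{T}|H^{(t)}|\le n\cdot 2^{O(\sqrt{\log n})}$: there is an absolute constant $K>0$ with $\sum_{t=0}^{T}|H^{(t)}|\le n\cdot 2^{K\sqrt{\log_2 n}}$ for all $n,U,\epsilon,\alpha,L,b,\mathcal C$ and all such runs. -/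

import Mathlib

open Finset

noncomputable section

namespace SDDM

variable {n : ℕ}

/-! ### SDDM matrices, norms, entrywise approximation -/

/-- An SDDM matrix: an invertible symmetric L-matrix that is row diagonally dominant. -/
structure IsSDDM (L : Matrix (Fin n) (Fin n) ℝ) : Prop where
  symm : L.IsSymm
  offDiag_nonpos : ∀ i j, i ≠ j → L i j ≤ 0
  diag_pos : ∀ i, 0 < L i i
  diagDominant : ∀ i, ∑ j ∈ univ.erase i, |L i j| ≤ |L i i|
  invertible : IsUnit L

/-- All entries of `L` are integers in `[-U, U]`. -/
def HasIntEntries (L : Matrix (Fin n) (Fin n) ℝ) (U : ℝ) : Prop :=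
  ∀ i j, (∃ z : ℤ, L i j = z) ∧ |L i j| ≤ U

/-- All entries of the vector `b` are integers in `[0, U]`. -/
def HasNonnegIntEntries (b : Fin n → ℝ) (U : ℝ) : Prop :=
  ∀ i, (∃ z : ℤ, b i = z) ∧ 0 ≤ b i ∧ b i ≤ U

/-- A symmetric matrix is irreducible when the graph of its nonzero off-diagonal entries
is connected. -/
def IsIrred (L : Matrix (Fin n) (Fin n) ℝ) : Prop :=
  (SimpleGraph.fromRel fun i j => L i j ≠ 0).Connected

/-- The principal submatrix `L_{H,H}`. -/
def principal (L : Matrix (Fin n) (Fin n) ℝ) (H : Finset (Fin n)) : Matrix H H ℝ :=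
  L.submatrix (fun i => (i : Fin n)) (fun i => (i : Fin n))

/-- The Euclidean norm of a vector. -/
def norm2 {ι : Type*} [Fintype ι] (v : ι → ℝ) : ℝ := Real.sqrt (∑ i, v i ^ 2)

/-- The `ℓ₁`-norm of the restriction of `v` to the index set `S`. -/
def norm1On (S : Finset (Fin n)) (v : Fin n → ℝ) : ℝ := ∑ i ∈ S, |v i|

/-- `x` is an entrywise `exp(η)`-approximation of `y` on the index set `S`. -/
def EntrywiseApprox (η : ℝ) (S : Finset (Fin n)) (x y : Fin n → ℝ) : Prop :=
  ∀ i ∈ S, Real.exp (-η) * y i ≤ x i ∧ x i ≤ Real.exp η * y i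

/-! ### Low-diameter covers -/

/-- The probability distance `D_L(i,j) = -log_{nU} ((L⁻¹)_{ij}) + 2`. It is used for irreducible
SDDM matrices only, for which every entry of `L⁻¹` is positive. -/
def probDist (L : Matrix (Fin n) (Fin n) ℝ) (U : ℝ) (i j : Fin n) : ℝ :=
  -Real.logb (n * U) (L⁻¹ i j) + 2

/-- A set `C` of pairs `(V, W)` (inner ball, outer ball) is an `(rin, rout, α)`-cover for `L`. -/
structure IsCover (L : Matrix (Fin n) (Fin n) ℝ) (U rin rout α : ℝ)
    (C : Finset (Finset (Fin n) × Finset (Fin n))) : Prop where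
  inner_subset : ∀ p ∈ C, p.1 ⊆ p.2
  covers : ∀ u, ∃ p ∈ C, u ∈ p.1
  overlap : ∀ u, ((C.filter fun p => u ∈ p.2).card : ℝ) ≤ α
  diam : ∀ p ∈ C, ∀ u ∈ p.2, ∀ v ∈ p.2, probDist L U u v ≤ rin
  gap : ∀ p ∈ C, ∀ u ∈ p.1, ∀ v, v ∉ p.2 → rout < probDist L U u v

/-- `ℓ = ⌈√(log₂ n)⌉ + 3`. -/
def ell (n : ℕ) : ℕ := ⌈Real.sqrt (Real.logb 2 n)⌉₊ + 3

/-- `r_in = 2^(2ℓ+1)`. -/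
def rIn (n : ℕ) : ℕ := 2 ^ (2 * ell n + 1)

/-- `r_out = 2^(ℓ-2)`; note that `ℓ ≥ 3`. -/
def rOut (n : ℕ) : ℕ := 2 ^ (ell n - 2)

/-- The boundary-expanded set `Exp_C(I)`. -/
def expandedSet (C : Finset (Finset (Fin n) × Finset (Fin n))) (I : Finset (Fin n)) :
    Finset (Fin n) :=
  univ.filter fun u => ∃ p ∈ C, u ∈ p.1 ∧ 0 < (p.2 ∩ I).card

/-- `{u ∈ S : v_u > 0}`. -/
def posSupport (S : Finset (Fin n)) (v : Fin n → ℝ) : Finset (Fin n) :=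
  S.filter fun u => 0 < v u

/-- The active set `Exp_C(I) ∩ S`, where `I = {u ∈ S : b̂_u > 0}`. -/
def activeSet (C : Finset (Finset (Fin n) × Finset (Fin n))) (S : Finset (Fin n))
    (bhat : Fin n → ℝ) : Finset (Fin n) :=
  expandedSet C (posSupport S bhat) ∩ S

/-! ### The algorithm -/

/-- `y` meets the accuracy guarantee of a normwise solver called on `M y = c` with accuracy `η`:
`‖y - M⁻¹ c‖₂ ≤ η ‖c‖₂`. -/
def IsLaplacianSolve {ι : Type*} [Fintype ι] [DecidableEq ι] (M : Matrix ι ι ℝ) (c : ι → ℝ)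
    (η : ℝ) (y : ι → ℝ) : Prop :=
  norm2 (y - M⁻¹.mulVec c) ≤ η * norm2 c

/-- `xhat`, a vector on `S`, is an output of PartialSolve on `L_{S,S} x = b̂` with accuracy `εL`:
with `H` the active set and `Z = ‖b̂_H‖₁`, the normwise solver is called on
`(L_{H,H}, b̂_H / Z, εL / 2)` and succeeds, its output is multiplied by `Z`, and the result is
extended by zero to `S`. -/
def IsPartialSolve (L : Matrix (Fin n) (Fin n) ℝ)
    (C : Finset (Finset (Fin n) × Finset (Fin n))) (S : Finset (Fin n)) (bhat : Fin n → ℝ)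
    (εL : ℝ) (xhat : Fin n → ℝ) : Prop :=
  (∃ y : activeSet C S bhat → ℝ,
    IsLaplacianSolve (principal L (activeSet C S bhat))
      (fun i => bhat i / norm1On (activeSet C S bhat) bhat) (εL / 2) y ∧
    ∀ i : activeSet C S bhat, xhat i = norm1On (activeSet C S bhat) bhat * y i) ∧
  ∀ i ∈ S \ activeSet C S bhat, xhat i = 0

/-- `θ` is the smallest power of two larger than `q ≥ 0`. For `q = 0` there is no smallest one,
and `θ` may then be any power of two. -/
def IsThreshold (q θ : ℝ) : Prop :=
  (∃ k : ℤ, θ = 2 ^ k) ∧ q < θ ∧ (0 < q → ∀ k : ℤ, q < 2 ^ k → θ ≤ 2 ^ k)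

/-- The variables of the algorithm, indexed by the iteration. Vectors that the algorithm keeps on
a subset of the indices are stored as vectors on all of `Fin n`; the other entries are
irrelevant. -/
structure Trace (n : ℕ) where
  /-- the indices not yet solved, `S^(t)` -/
  S : ℕ → Finset (Fin n)
  /-- the indices solved in iteration `t`, `F^(t)` -/
  F : ℕ → Finset (Fin n)
  /-- the right-hand side `b̂^(t)`, on `S^(t)` -/
  bhat : ℕ → Fin n → ℝ
  /-- the approximate solution `x̂^(t)` of the current system, on `S^(t)` -/
  xhat : ℕ → Fin n → ℝ
  /-- the values computed so far `x̃^(t)`, on the complement of `S^(t)` -/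
  xtil : ℕ → Fin n → ℝ
  /-- the threshold `θ_t` -/
  θ : ℕ → ℝ

/-- The active set `H^(t)`. -/
def Trace.H (R : Trace n) (C : Finset (Finset (Fin n) × Finset (Fin n))) (t : ℕ) :
    Finset (Fin n) :=
  activeSet C (R.S t) (R.bhat t)

/-- `R` records a run of SDDMSolve on `(L, b, ε)` that uses the cover `C`: ThresholdDecay with
`T = n`, iterations `t = 0, …, T`, and PartialSolve as the solver, all calls of the normwise
solver being successful. -/
structure IsRun (L : Matrix (Fin n) (Fin n) ℝ) (b : Fin n → ℝ) (U ε : ℝ)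
    (C : Finset (Finset (Fin n) × Finset (Fin n))) (R : Trace n) : Prop where
  init_S : R.S 0 = univ
  init_bhat : R.bhat 0 = b
  solve : ∀ t ≤ n,
    IsPartialSolve L C (R.S t) (R.bhat t) (ε / (64 * n * (n * U) ^ 2)) (R.xhat t)
  threshold : ∀ t ≤ n,
    IsThreshold (1 / (4 * (n * U) ^ 2) * norm1On (R.S t) (R.bhat t)) (R.θ t)
  extract : ∀ t ≤ n, R.F t = (R.S t).filter fun i => R.θ t ≤ R.xhat t i
  update_S : ∀ t ≤ n, R.S (t + 1) = R.S t \ R.F t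
  update_xtil_old : ∀ t ≤ n, ∀ i ∉ R.S t, R.xtil (t + 1) i = R.xtil t i
  update_xtil_new : ∀ t ≤ n, ∀ i ∈ R.F t, R.xtil (t + 1) i = R.xhat t i
  update_bhat : ∀ t ≤ n,
    EntrywiseApprox (ε / (8 * n)) (R.S (t + 1)) (R.bhat (t + 1))
      (fun i => b i - ∑ j ∈ univ \ R.S (t + 1), L i j * R.xtil (t + 1) j)

end SDDM

end

/-! Write x = L⁻¹b and B = nU. The active iterations of a vertex u lie within `rIn n` iterations of
the first one, because u is solved by then.

Thresholds decay: an entry left unsolved by iteration t is at most 1.3 θ_t, so the next right-hand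
side has entries at most 2Uθ_t, and θ_{t+1} B ≤ θ_t as long as that right-hand side is nonzero
(`θ_succ_mul_le`).

Suppose u first becomes active at t. Some v in an outer ball whose inner ball contains u then has
positive right-hand side. If t > 0, this was not so one step earlier, or u would have been active
already; hence a neighbour of v was just solved, with an entry of order at least θ_{t-1}, and x_v is
at least 1/U times that entry. If t = 0, integrality gives b_v ≥ 1. Either way θ_t B is at most a
constant times U x_v (`exists_large_of_first`). The cover's diameter bound makes (L⁻¹)_{uv} at least
B^{2-r_in}, and `hitting_le` with (L⁻¹)_{vv} ≤ n² turns this into U² x_v ≤ x_u B^{r_in}. If u were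
unsolved after r_in further iterations, the decay would give x_u B^{r_in} ≤ 1.3 θ_t B < 2U x_v ≤ U²
x_v, a contradiction (`solved_after_first`).

This needs the computed values to approximate x entrywise throughout (`accurate`). The cover's gap
makes the restriction to H harmless, the solver error is small against θ_t, and only entries at
least θ_t are kept, so additive errors become relative ones. All comparisons of solutions come from
a maximum principle, itself a consequence of an energy bound. -/

namespace SDDM

variable {n : ℕ}

/-! ### Energy of an SDDM matrix -/

/-- The row sums of an SDDM matrix are nonnegative. -/
lemma IsSDDM.rowSum_nonneg {L : Matrix (Fin n) (Fin n) ℝ} (h : IsSDDM L) (i : Fin n) :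
    0 ≤ ∑ j, L i j := by
  have h1 := h.diagDominant i
  rw [abs_of_pos (h.diag_pos i)] at h1
  rw [← Finset.add_sum_erase _ _ (mem_univ i)]
  have h2 : ∑ j ∈ univ.erase i, -|L i j| ≤ ∑ j ∈ univ.erase i, L i j :=
    Finset.sum_le_sum fun j _ => neg_abs_le _
  rw [Finset.sum_neg_distrib] at h2
  linarith

lemma sum_mul_diff_sq {L : Matrix (Fin n) (Fin n) ℝ} (h : L.IsSymm) (w : Fin n → ℝ) :
    ∑ i, ∑ j, w i * (L i j * w j) =
      ∑ i, (∑ j, L i j) * w i ^ 2 + (∑ i, ∑ j, -L i j * (w i - w j) ^ 2) / 2 := by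
  have h1 : ∑ i, ∑ j, L i j * w j ^ 2 = ∑ i, ∑ j, L i j * w i ^ 2 := by
    rw [Finset.sum_comm]
    refine Finset.sum_congr rfl fun i _ => Finset.sum_congr rfl fun j _ => ?_
    rw [h.apply]
  have h2 : ∑ i, ∑ j, -L i j * (w i - w j) ^ 2 =
      2 * ∑ i, ∑ j, w i * (L i j * w j) - ∑ i, ∑ j, L i j * w i ^ 2
        - ∑ i, ∑ j, L i j * w j ^ 2 := by
    simp only [Finset.mul_sum, ← Finset.sum_sub_distrib]
    refine Finset.sum_congr rfl fun i _ => Finset.sum_congr rfl fun j _ => ?_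
    ring
  rw [h2, h1]
  simp only [Finset.sum_mul]
  ring

/-- The energy of `w` as a sum over the vertices and the edges. -/
lemma IsSDDM.energy_eq {L : Matrix (Fin n) (Fin n) ℝ} (h : IsSDDM L) (w : Fin n → ℝ) :
    w ⬝ᵥ L.mulVec w =
      ∑ i, (∑ j, L i j) * w i ^ 2 + (∑ i, ∑ j, -L i j * (w i - w j) ^ 2) / 2 := by
  rw [← sum_mul_diff_sq h.symm]
  simp only [dotProduct, Matrix.mulVec, Finset.mul_sum]

lemma IsSDDM.edge_term_nonneg {L : Matrix (Fin n) (Fin n) ℝ} (h : IsSDDM L) (w : Fin n → ℝ)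
    (i j : Fin n) : 0 ≤ -L i j * (w i - w j) ^ 2 := by
  rcases eq_or_ne i j with rfl | hij
  · simp
  · exact mul_nonneg (by linarith [h.offDiag_nonpos i j hij]) (sq_nonneg _)

lemma IsSDDM.excess_le_energy {L : Matrix (Fin n) (Fin n) ℝ} (h : IsSDDM L) (w : Fin n → ℝ)
    (r : Fin n) (hr : 1 ≤ ∑ j, L r j) : w r ^ 2 ≤ w ⬝ᵥ L.mulVec w := by
  rw [h.energy_eq]
  have h1 : (∑ j, L r j) * w r ^ 2 ≤ ∑ i, (∑ j, L i j) * w i ^ 2 :=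
    Finset.single_le_sum (f := fun i => (∑ j, L i j) * w i ^ 2)
      (fun i _ => mul_nonneg (h.rowSum_nonneg i) (sq_nonneg _)) (mem_univ r)
  have h2 : 0 ≤ ∑ i, ∑ j, -L i j * (w i - w j) ^ 2 :=
    Finset.sum_nonneg fun i _ => Finset.sum_nonneg fun j _ => h.edge_term_nonneg w i j
  nlinarith [sq_nonneg (w r)]

/-- The edge occurs in the double sum as (i, j) and as (j, i), which cancels the factor 1/2. -/
lemma IsSDDM.edge_le_energy {L : Matrix (Fin n) (Fin n) ℝ} (h : IsSDDM L) (w : Fin n → ℝ)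
    {i j : Fin n} (hij : i ≠ j) (hL : L i j ≤ -1) : (w i - w j) ^ 2 ≤ w ⬝ᵥ L.mulVec w := by
  rw [h.energy_eq]
  have h1 : 0 ≤ ∑ i, (∑ j, L i j) * w i ^ 2 :=
    Finset.sum_nonneg fun i _ => mul_nonneg (h.rowSum_nonneg i) (sq_nonneg _)
  have hin : ∀ a b, -L a b * (w a - w b) ^ 2 ≤ ∑ j, -L a j * (w a - w j) ^ 2 := fun a b =>
    Finset.single_le_sum (f := fun j => -L a j * (w a - w j) ^ 2)
      (fun j _ => h.edge_term_nonneg w a j) (mem_univ b)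
  have h2 : ∑ a ∈ ({i, j} : Finset (Fin n)), ∑ b, -L a b * (w a - w b) ^ 2 ≤
      ∑ i, ∑ j, -L i j * (w i - w j) ^ 2 :=
    Finset.sum_le_sum_of_subset_of_nonneg (subset_univ _)
      fun a _ _ => Finset.sum_nonneg fun b _ => h.edge_term_nonneg w a b
  rw [Finset.sum_pair hij] at h2
  have h3 := hin i j
  have h4 := hin j i
  have h5 : L j i = L i j := h.symm.apply i j
  rw [h5] at h4
  nlinarith [sq_nonneg (w i - w j)]

lemma HasIntEntries.le_neg_one {L : Matrix (Fin n) (Fin n) ℝ} {U : ℝ} (hI : HasIntEntries L U)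
    (h : IsSDDM L) {i j : Fin n} (hij : i ≠ j) (h0 : L i j ≠ 0) : L i j ≤ -1 := by
  obtain ⟨⟨z, hz⟩, -⟩ := hI i j
  have h1 := lt_of_le_of_ne (h.offDiag_nonpos i j hij) h0
  rw [hz] at h1 ⊢
  have : z < 0 := by exact_mod_cast h1
  have : z ≤ -1 := by omega
  exact_mod_cast this

/-- Otherwise integrality makes every row sum 0, so the all-ones vector lies in the kernel of an
invertible matrix. -/
lemma HasIntEntries.exists_excess {L : Matrix (Fin n) (Fin n) ℝ} {U : ℝ}
    (hI : HasIntEntries L U) (h : IsSDDM L) (hn : 0 < n) : ∃ r, 1 ≤ ∑ j, L r j := by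
  by_contra! hcon
  have h0 : ∀ r, ∑ j, L r j = 0 := by
    intro r
    choose z hz using fun j => (hI r j).1
    have h1 := hcon r
    have h2 := h.rowSum_nonneg r
    simp only [hz] at h1 h2 ⊢
    have h1' : ∑ j, z j < 1 := by exact_mod_cast h1
    have h2' : 0 ≤ ∑ j, z j := by exact_mod_cast h2
    have : ∑ j, z j = 0 := by omega
    exact_mod_cast this
  have h1 : L.mulVec (fun _ => 1) = L.mulVec 0 := by
    ext i
    simp [Matrix.mulVec, dotProduct, h0]
  have h2 := Matrix.mulVec_injective_of_isUnit h.invertible h1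
  have h3 := congrFun h2 ⟨0, hn⟩
  simp at h3

lemma abs_sub_le_of_walk {V : Type*} {G : SimpleGraph V} (w : V → ℝ) (s : ℝ)
    (hs : ∀ i j, G.Adj i j → |w i - w j| ≤ s) {a b : V} (p : G.Walk a b) :
    |w a - w b| ≤ p.length * s := by
  induction p with
  | nil => simp
  | @cons u v x huv q ih =>
    have h1 := hs _ _ huv
    have h2 := abs_sub_le (w u) (w v) (w x)
    simp only [SimpleGraph.Walk.length_cons, Nat.cast_add, Nat.cast_one]
    linarith

/-- The energy bound behind positive definiteness. -/
lemma sq_le_energy {L : Matrix (Fin n) (Fin n) ℝ} {U : ℝ}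
    (hI : HasIntEntries L U) (h : IsSDDM L) (hirr : IsIrred L) (w : Fin n → ℝ) (v : Fin n) :
    w v ^ 2 ≤ (n : ℝ) ^ 2 * (w ⬝ᵥ L.mulVec w) := by
  obtain ⟨r, hr⟩ := hI.exists_excess h v.pos
  have hE := h.excess_le_energy w r hr
  set E := w ⬝ᵥ L.mulVec w
  have hE0 : 0 ≤ E := (sq_nonneg _).trans hE
  have hadj : ∀ i j, (SimpleGraph.fromRel fun i j => L i j ≠ 0).Adj i j →
      |w i - w j| ≤ Real.sqrt E := by
    intro i j hij
    rw [SimpleGraph.fromRel_adj] at hij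
    obtain ⟨hne, hL⟩ := hij
    have hL' : L i j ≠ 0 := by
      rcases hL with h' | h'
      · exact h'
      · rwa [← h.symm.apply]
    exact Real.abs_le_sqrt (h.edge_le_energy w hne (hI.le_neg_one h hne hL'))
  -- A simple path to a row r of positive excess has at most n - 1 edges. Each edge contributes at
  -- most √E, and so does |w r|, for a total of n√E.
  obtain ⟨p, hp⟩ := (hirr.preconnected v r).exists_isPath
  have h1 := abs_sub_le_of_walk w _ hadj p
  have hlen : (p.length : ℝ) + 1 ≤ n := by
    have := hp.length_lt
    rw [Fintype.card_fin] at this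
    exact_mod_cast this
  have h2 : |w r| ≤ Real.sqrt E := Real.abs_le_sqrt hE
  have h3 : |w v| ≤ n * Real.sqrt E := by
    have h4 : |w v| ≤ |w v - w r| + |w r| := by
      simpa using abs_add_le (w v - w r) (w r)
    nlinarith [Real.sqrt_nonneg E]
  calc w v ^ 2 = |w v| ^ 2 := (sq_abs _).symm
    _ ≤ (n * Real.sqrt E) ^ 2 := by gcongr
    _ = _ := by rw [mul_pow, Real.sq_sqrt hE0]

/-! ### Maximum principle and entries of the inverse -/

/-- Maximum principle. -/
lemma nonpos_of_mulVec_nonpos {L : Matrix (Fin n) (Fin n) ℝ} {U : ℝ}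
    (hI : HasIntEntries L U) (h : IsSDDM L) (hirr : IsIrred L) (H : Finset (Fin n))
    (z : Fin n → ℝ) (hin : ∀ i ∈ H, L.mulVec z i ≤ 0) (hout : ∀ i ∉ H, z i ≤ 0) (i : Fin n) :
    z i ≤ 0 := by
  set p : Fin n → ℝ := fun i => max (z i) 0 with hp
  have hp0 : ∀ i, 0 ≤ p i := fun i => le_max_right _ _
  have hpz : ∀ i, z i ≤ p i := fun i => le_max_left _ _
  -- Test with the positive part: off the diagonal L ≤ 0 and z ≤ p, while on the diagonal p² = pz.
  -- Hence the energy of p is at most p·Lz ≤ 0, and p vanishes.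
  have h1 : p ⬝ᵥ L.mulVec p ≤ p ⬝ᵥ L.mulVec z := by
    simp only [dotProduct, Matrix.mulVec, Finset.mul_sum]
    refine Finset.sum_le_sum fun i _ => Finset.sum_le_sum fun j _ => ?_
    rcases eq_or_ne i j with rfl | hij
    · rcases le_total (z i) 0 with hz | hz
      · simp [hp, max_eq_right hz]
      · simp [hp, max_eq_left hz]
    · exact mul_le_mul_of_nonneg_left
        (mul_le_mul_of_nonpos_left (hpz j) (h.offDiag_nonpos i j hij)) (hp0 i)
  have h2 : p ⬝ᵥ L.mulVec z ≤ 0 := by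
    refine Finset.sum_nonpos fun i _ => ?_
    by_cases hi : i ∈ H
    · exact mul_nonpos_of_nonneg_of_nonpos (hp0 i) (hin i hi)
    · simp [hp, max_eq_right (hout i hi)]
  have h3 := sq_le_energy hI h hirr p i
  have h4 : p i ^ 2 ≤ 0 := h3.trans
    (mul_nonpos_of_nonneg_of_nonpos (by positivity) (h1.trans h2))
  have h5 : p i = 0 := by
    have := le_antisymm h4 (sq_nonneg _)
    exact pow_eq_zero_iff (two_ne_zero) |>.1 this
  exact (hpz i).trans h5.le

lemma nonneg_of_mulVec_nonneg {L : Matrix (Fin n) (Fin n) ℝ} {U : ℝ}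
    (hI : HasIntEntries L U) (h : IsSDDM L) (hirr : IsIrred L) (H : Finset (Fin n))
    (z : Fin n → ℝ) (hin : ∀ i ∈ H, 0 ≤ L.mulVec z i) (hout : ∀ i ∉ H, 0 ≤ z i) (i : Fin n) :
    0 ≤ z i := by
  have := nonpos_of_mulVec_nonpos hI h hirr H (-z)
    (fun i hi => by rw [Matrix.mulVec_neg]; simpa using hin i hi)
    (fun i hi => by simpa using hout i hi) i
  simpa using this

lemma le_of_mulVec_le {L : Matrix (Fin n) (Fin n) ℝ} {U : ℝ}
    (hI : HasIntEntries L U) (h : IsSDDM L) (hirr : IsIrred L) (H : Finset (Fin n))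
    (z w : Fin n → ℝ) (hin : ∀ i ∈ H, L.mulVec z i ≤ L.mulVec w i) (hout : ∀ i ∉ H, z i ≤ w i)
    (i : Fin n) : z i ≤ w i := by
  have := nonneg_of_mulVec_nonneg hI h hirr H (w - z)
    (fun i hi => by rw [Matrix.mulVec_sub]; simpa using hin i hi)
    (fun i hi => by simpa using hout i hi) i
  simpa using this

lemma IsSDDM.mulVec_inv {L : Matrix (Fin n) (Fin n) ℝ} (h : IsSDDM L) (c : Fin n → ℝ) :
    L.mulVec (L⁻¹.mulVec c) = c := by
  rw [Matrix.mulVec_mulVec, Matrix.mul_nonsing_inv _ ((Matrix.isUnit_iff_isUnit_det _).1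
    h.invertible), Matrix.one_mulVec]

lemma IsSDDM.mulVec_inv_col {L : Matrix (Fin n) (Fin n) ℝ} (h : IsSDDM L) (v : Fin n) :
    L.mulVec (fun u => L⁻¹ u v) = Pi.single v 1 := by
  have := h.mulVec_inv (Pi.single v 1)
  rwa [Matrix.mulVec_single_one] at this

lemma inv_nonneg {L : Matrix (Fin n) (Fin n) ℝ} {U : ℝ}
    (hI : HasIntEntries L U) (h : IsSDDM L) (hirr : IsIrred L) (u v : Fin n) : 0 ≤ L⁻¹ u v := by
  refine nonneg_of_mulVec_nonneg hI h hirr univ (fun u => L⁻¹ u v) (fun i _ => ?_)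
    (fun i hi => absurd (mem_univ i) hi) u
  rw [h.mulVec_inv_col]
  by_cases hiv : i = v
  · subst hiv; simp
  · simp [hiv]

/-- A zero of the nonnegative column v lies off v, and since the row equation there has only
nonpositive terms, the zero spreads to all neighbours. By connectedness it would reach v. -/
lemma inv_pos {L : Matrix (Fin n) (Fin n) ℝ} {U : ℝ}
    (hI : HasIntEntries L U) (h : IsSDDM L) (hirr : IsIrred L) (u v : Fin n) : 0 < L⁻¹ u v := by
  have hg := fun i => inv_nonneg hI h hirr i v
  have hz : ∀ i, L⁻¹ i v = 0 → i ≠ v ∧ ∀ j, j ≠ i → L i j ≠ 0 → L⁻¹ j v = 0 := by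
    intro i hi
    have h1 := congrFun (h.mulVec_inv_col v) i
    simp only [Matrix.mulVec, dotProduct] at h1
    have hterm : ∀ j, L i j * L⁻¹ j v ≤ 0 := by
      intro j
      rcases eq_or_ne i j with rfl | hij
      · simp [hi]
      · exact mul_nonpos_of_nonpos_of_nonneg (h.offDiag_nonpos i j hij) (hg j)
    have h2 : ∑ j, L i j * L⁻¹ j v ≤ 0 := Finset.sum_nonpos fun j _ => hterm j
    have hiv : i ≠ v := by
      rintro rfl
      rw [h1] at h2
      simp at h2
      linarith
    refine ⟨hiv, fun j _ hL => ?_⟩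
    rw [Pi.single_eq_of_ne hiv] at h1
    have h3 := (Finset.sum_eq_zero_iff_of_nonpos (fun j _ => hterm j)).1 h1 j (mem_univ j)
    exact (mul_eq_zero.1 h3).resolve_left hL
  refine lt_of_le_of_ne (hg u) fun h0 => ?_
  obtain ⟨p⟩ := hirr.preconnected u v
  have hall : ∀ {a b : Fin n} (p : (SimpleGraph.fromRel fun i j => L i j ≠ 0).Walk a b),
      L⁻¹ a v = 0 → L⁻¹ b v = 0 := by
    intro a b p
    induction p with
    | nil => exact id
    | @cons a c _ hac q ih =>
      intro ha
      rw [SimpleGraph.fromRel_adj] at hac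
      obtain ⟨hne, hL⟩ := hac
      refine ih ((hz a ha).2 c hne.symm ?_)
      rcases hL with h' | h'
      · exact h'
      · rwa [← h.symm.apply]
  exact (hz v (hall p h0.symm)).1 rfl

/-- The energy of column v of L⁻¹ is its own entry at v, so the energy bound reads g² ≤ n² g. -/
lemma inv_diag_le {L : Matrix (Fin n) (Fin n) ℝ} {U : ℝ}
    (hI : HasIntEntries L U) (h : IsSDDM L) (hirr : IsIrred L) (v : Fin n) :
    L⁻¹ v v ≤ (n : ℝ) ^ 2 := by
  have h1 := sq_le_energy hI h hirr (fun u => L⁻¹ u v) v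
  rw [h.mulVec_inv_col, dotProduct_single_one] at h1
  have h2 := inv_pos hI h hirr v v
  nlinarith

/-- A nonnegative superharmonic vector dominates its value at `v` times the probability of
hitting `v`. -/
lemma hitting_le {L : Matrix (Fin n) (Fin n) ℝ} {U : ℝ}
    (hI : HasIntEntries L U) (h : IsSDDM L) (hirr : IsIrred L) (x : Fin n → ℝ)
    (hx : ∀ i, 0 ≤ L.mulVec x i) (u v : Fin n) : x v * L⁻¹ u v ≤ x u * L⁻¹ v v := by
  -- Both sides agree at v; elsewhere L maps the left side to 0 and the right side to something
  -- nonnegative.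
  have := le_of_mulVec_le hI h hirr (univ.erase v) (x v • fun u => L⁻¹ u v) (L⁻¹ v v • x)
    (fun i hi => by
      rw [Matrix.mulVec_smul, Matrix.mulVec_smul, h.mulVec_inv_col]
      simp only [Pi.smul_apply, Pi.single_eq_of_ne (Finset.ne_of_mem_erase hi), mul_zero,
        smul_eq_mul]
      exact mul_nonneg (inv_nonneg hI h hirr v v) (hx i))
    (fun i hi => by
      have : i = v := by simpa using hi
      subst this
      simp [mul_comm]) u
  simpa [mul_comm] using this

/-! ### Solutions of principal subsystems -/

/-- The solution of `L_{S,S} x = c_S`, extended by zero. -/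
noncomputable def extSolve (L : Matrix (Fin n) (Fin n) ℝ) (S : Finset (Fin n)) (c : Fin n → ℝ)
    (i : Fin n) : ℝ :=
  if hi : i ∈ S then (principal L S)⁻¹.mulVec (fun j : S => c j) ⟨i, hi⟩ else 0

lemma extSolve_of_notMem {L : Matrix (Fin n) (Fin n) ℝ} {S : Finset (Fin n)} {c : Fin n → ℝ}
    {i : Fin n} (hi : i ∉ S) : extSolve L S c i = 0 := dif_neg hi

lemma extSolve_coe (L : Matrix (Fin n) (Fin n) ℝ) (S : Finset (Fin n)) (c : Fin n → ℝ)
    (i : S) : extSolve L S c i = (principal L S)⁻¹.mulVec (fun j : S => c j) i := dif_pos i.2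

lemma mulVec_eq_principal_mulVec (L : Matrix (Fin n) (Fin n) ℝ) (S : Finset (Fin n))
    (z : Fin n → ℝ) (hz : ∀ i ∉ S, z i = 0) (i : S) :
    L.mulVec z i = (principal L S).mulVec (fun j : S => z j) i := by
  simp only [Matrix.mulVec, dotProduct, principal, Matrix.submatrix_apply]
  rw [Finset.sum_coe_sort S (fun j => L i j * z j)]
  refine (Finset.sum_subset (subset_univ S) fun j _ hj => ?_).symm
  simp [hz j hj]

/-- A kernel vector, extended by zero, is both nonpositive and nonnegative by the maximum principle.
-/
lemma isUnit_principal {L : Matrix (Fin n) (Fin n) ℝ} {U : ℝ}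
    (hI : HasIntEntries L U) (h : IsSDDM L) (hirr : IsIrred L) (S : Finset (Fin n)) :
    IsUnit (principal L S) := by
  rw [← Matrix.mulVec_injective_iff_isUnit]
  refine (injective_iff_map_eq_zero (principal L S).mulVecLin).2 fun z hz => ?_
  rw [Matrix.mulVecLin_apply] at hz
  set w : Fin n → ℝ := fun i => if hi : i ∈ S then z ⟨i, hi⟩ else 0 with hw
  have hw0 : ∀ i ∉ S, w i = 0 := fun i hi => dif_neg hi
  have hwS : (fun j : S => w j) = z := by ext j; simp [hw]
  have hLw : ∀ i ∈ S, L.mulVec w i = 0 := by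
    intro i hi
    have := mulVec_eq_principal_mulVec L S w hw0 ⟨i, hi⟩
    rw [hwS, hz] at this
    exact this
  ext j
  have h1 := nonpos_of_mulVec_nonpos hI h hirr S w (fun i hi => (hLw i hi).le)
    (fun i hi => (hw0 i hi).le) j
  have h2 := nonneg_of_mulVec_nonneg hI h hirr S w (fun i hi => (hLw i hi).ge)
    (fun i hi => (hw0 i hi).ge) j
  rw [← hwS]
  exact le_antisymm h1 h2

lemma mulVec_extSolve {L : Matrix (Fin n) (Fin n) ℝ} {U : ℝ}
    (hI : HasIntEntries L U) (h : IsSDDM L) (hirr : IsIrred L) (S : Finset (Fin n))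
    (c : Fin n → ℝ) {i : Fin n} (hi : i ∈ S) : L.mulVec (extSolve L S c) i = c i := by
  have h1 := mulVec_eq_principal_mulVec L S (extSolve L S c)
    (fun i hi => extSolve_of_notMem hi) ⟨i, hi⟩
  have h2 : (fun j : S => extSolve L S c j) = (principal L S)⁻¹.mulVec (fun j : S => c j) := by
    ext j; exact extSolve_coe L S c j
  rw [h2, Matrix.mulVec_mulVec, Matrix.mul_nonsing_inv _ ((Matrix.isUnit_iff_isUnit_det _).1
    (isUnit_principal hI h hirr S)), Matrix.one_mulVec] at h1
  exact h1

lemma extSolve_nonneg {L : Matrix (Fin n) (Fin n) ℝ} {U : ℝ}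
    (hI : HasIntEntries L U) (h : IsSDDM L) (hirr : IsIrred L) (S : Finset (Fin n))
    (c : Fin n → ℝ) (hc : ∀ i ∈ S, 0 ≤ c i) (i : Fin n) : 0 ≤ extSolve L S c i :=
  nonneg_of_mulVec_nonneg hI h hirr S _
    (fun i hi => by rw [mulVec_extSolve hI h hirr S c hi]; exact hc i hi)
    (fun i hi => (extSolve_of_notMem hi).ge) i

end SDDM

namespace SDDM

variable {n : ℕ}

/-! ### Probability distance and the error of a partial solve -/

lemma sq_le_inv_mul_pow {L : Matrix (Fin n) (Fin n) ℝ} {U : ℝ} {u v : Fin n} {r : ℕ}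
    (hB : 1 < n * U) (hpos : 0 < L⁻¹ u v) (hD : probDist L U u v ≤ r) :
    (n * U) ^ 2 ≤ L⁻¹ u v * (n * U) ^ r := by
  have h1 : (2 : ℝ) - r ≤ Real.logb (n * U) (L⁻¹ u v) := by
    unfold probDist at hD; linarith
  have hB0 : 0 < n * U := by linarith
  rw [Real.le_logb_iff_rpow_le hB hpos, Real.rpow_sub hB0, Real.rpow_natCast,
    div_le_iff₀ (by positivity)] at h1
  exact_mod_cast h1

lemma inv_mul_pow_le_sq {L : Matrix (Fin n) (Fin n) ℝ} {U : ℝ} {u v : Fin n} {r : ℕ}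
    (hB : 1 < n * U) (hpos : 0 < L⁻¹ u v) (hD : r < probDist L U u v) :
    L⁻¹ u v * (n * U) ^ r ≤ (n * U) ^ 2 := by
  have h1 : Real.logb (n * U) (L⁻¹ u v) ≤ (2 : ℝ) - r := by
    unfold probDist at hD; linarith
  have hB0 : 0 < n * U := by linarith
  rw [Real.logb_le_iff_le_rpow hB hpos, Real.rpow_sub hB0, Real.rpow_natCast,
    le_div_iff₀ (by positivity)] at h1
  exact_mod_cast h1

lemma extSolve_mono_set {L : Matrix (Fin n) (Fin n) ℝ} {U : ℝ}
    (hI : HasIntEntries L U) (h : IsSDDM L) (hirr : IsIrred L) {H S : Finset (Fin n)}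
    (hHS : H ⊆ S) (c : Fin n → ℝ) (hc : ∀ i ∈ S, 0 ≤ c i) (i : Fin n) :
    extSolve L H c i ≤ extSolve L S c i :=
  le_of_mulVec_le hI h hirr H _ _
    (fun i hi => by
      rw [mulVec_extSolve hI h hirr H c hi, mulVec_extSolve hI h hirr S c (hHS hi)])
    (fun i hi => by
      rw [extSolve_of_notMem hi]
      exact extSolve_nonneg hI h hirr S c hc i) i

/-- Restricting the system from `S` to a set `H` containing the support of the right-hand side
changes the solution by at most the largest entry outside `H`. -/
lemma extSolve_sub_le {L : Matrix (Fin n) (Fin n) ℝ} {U : ℝ}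
    (hI : HasIntEntries L U) (h : IsSDDM L) (hirr : IsIrred L) {H S : Finset (Fin n)}
    (hHS : H ⊆ S) (c : Fin n → ℝ) (hc : ∀ i ∈ S, 0 ≤ c i) {m : ℝ} (hm : 0 ≤ m)
    (hinv : ∀ w ∈ S \ H, ∀ v ∈ S, 0 < c v → L⁻¹ w v ≤ m) (i : Fin n) :
    extSolve L S c i - extSolve L H c i ≤ m * norm1On S c := by
  have hβ : 0 ≤ norm1On S c := Finset.sum_nonneg fun _ _ => abs_nonneg _
  set d : Fin n → ℝ := fun i => if i ∈ S then c i else 0 with hd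
  have hd0 : ∀ i, 0 ≤ d i := by
    intro i
    by_cases hi : i ∈ S
    · simpa [hd, hi] using hc i hi
    · simp [hd, hi]
  -- The full inverse dominates the solution on S, so the bound on the entries of L⁻¹ controls it
  -- outside H.
  have hg : ∀ i, extSolve L S c i ≤ L⁻¹.mulVec d i := by
    refine le_of_mulVec_le hI h hirr S _ _ (fun i hi => ?_) (fun i hi => ?_)
    · rw [mulVec_extSolve hI h hirr S c hi, h.mulVec_inv]
      simp [hd, hi]
    · rw [extSolve_of_notMem hi]
      simp only [Matrix.mulVec, dotProduct]
      exact Finset.sum_nonneg fun j _ => mul_nonneg (inv_nonneg hI h hirr i j) (hd0 j)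
  have hout : ∀ w ∉ H, extSolve L S c w ≤ m * norm1On S c := by
    intro w hw
    by_cases hwS : w ∈ S
    · refine (hg w).trans ?_
      have h1 : L⁻¹.mulVec d w = ∑ v ∈ S, L⁻¹ w v * c v := by
        simp [Matrix.mulVec, dotProduct, hd, Finset.sum_ite_mem]
      rw [h1, norm1On, Finset.mul_sum]
      refine Finset.sum_le_sum fun v hv => ?_
      rw [abs_of_nonneg (hc v hv)]
      rcases (hc v hv).eq_or_lt with h0 | h0
      · simp [← h0]
      · exact mul_le_mul_of_nonneg_right (hinv w (by simp [hwS, hw]) v hv h0) h0.le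
    · rw [extSolve_of_notMem hwS]
      positivity
  -- Row sums are nonnegative, so L maps a nonnegative constant to a nonnegative vector; adding the
  -- constant that bounds the solution outside H therefore gives a majorant everywhere.
  have := le_of_mulVec_le hI h hirr H (extSolve L S c)
    (extSolve L H c + fun _ => m * norm1On S c)
    (fun i hi => by
      rw [Matrix.mulVec_add, Pi.add_apply, mulVec_extSolve hI h hirr H c hi,
        mulVec_extSolve hI h hirr S c (hHS hi)]
      have : L.mulVec (fun _ => m * norm1On S c) i = (∑ j, L i j) * (m * norm1On S c) := by
        simp [Matrix.mulVec, dotProduct, Finset.sum_mul]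
      rw [this]
      have := mul_nonneg (h.rowSum_nonneg i) (mul_nonneg hm hβ)
      linarith)
    (fun i hi => by
      rw [Pi.add_apply, extSolve_of_notMem hi, zero_add]
      exact hout i hi) i
  rw [Pi.add_apply] at this
  linarith

lemma activeSet_subset (C : Finset (Finset (Fin n) × Finset (Fin n))) (S : Finset (Fin n))
    (c : Fin n → ℝ) : activeSet C S c ⊆ S := Finset.inter_subset_right

lemma mem_activeSet {C : Finset (Finset (Fin n) × Finset (Fin n))} {S : Finset (Fin n)}
    {c : Fin n → ℝ} {u : Fin n} :
    u ∈ activeSet C S c ↔ u ∈ S ∧ ∃ p ∈ C, u ∈ p.1 ∧ ∃ v ∈ p.2, v ∈ S ∧ 0 < c v := by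
  simp only [activeSet, expandedSet, posSupport, Finset.mem_inter, Finset.mem_filter,
    Finset.mem_univ, true_and, Finset.card_pos, Finset.Nonempty]
  exact and_comm

/-- A vertex w of S outside the active set lies in an inner ball whose outer ball misses the support
of c, so the gap condition bounds (L⁻¹)_{wv} for all v in the support. -/
lemma extSolve_sub_activeSet_le {L : Matrix (Fin n) (Fin n) ℝ} {U rin α : ℝ} {rout : ℕ}
    (hI : HasIntEntries L U) (h : IsSDDM L) (hirr : IsIrred L) (hB : 1 < n * U)
    {C : Finset (Finset (Fin n) × Finset (Fin n))} (hC : IsCover L U rin rout α C)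
    (S : Finset (Fin n)) (c : Fin n → ℝ) (hc : ∀ i ∈ S, 0 ≤ c i) (i : Fin n) :
    extSolve L S c i - extSolve L (activeSet C S c) c i ≤
      (n * U) ^ 2 / (n * U) ^ rout * norm1On S c := by
  have hB0 : 0 < n * U := by linarith
  refine extSolve_sub_le hI h hirr (activeSet_subset C S c) c hc (by positivity) ?_ i
  intro w hw v hv hcv
  rw [Finset.mem_sdiff, mem_activeSet] at hw
  obtain ⟨p, hp, hwp⟩ := hC.covers w
  have hvp : v ∉ p.2 := fun hvp => hw.2 ⟨hw.1, p, hp, hwp, v, hvp, hv, hcv⟩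
  rw [le_div_iff₀ (by positivity)]
  exact inv_mul_pow_le_sq hB (inv_pos hI h hirr w v) (hC.gap p hp w hwp v hvp)

lemma abs_le_norm2 {ι : Type*} [Fintype ι] (v : ι → ℝ) (i : ι) : |v i| ≤ norm2 v :=
  Real.abs_le_sqrt (Finset.single_le_sum (f := fun i => v i ^ 2) (fun _ _ => sq_nonneg _)
    (mem_univ i))

lemma norm2_normalized_le_one (H : Finset (Fin n)) (c : Fin n → ℝ) :
    norm2 (fun i : H => c i / norm1On H c) ≤ 1 := by
  refine Real.sqrt_le_one.2 ?_
  have hZ : 0 ≤ norm1On H c := Finset.sum_nonneg fun _ _ => abs_nonneg _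
  rw [Finset.sum_coe_sort H (fun i => (c i / norm1On H c) ^ 2)]
  calc ∑ i ∈ H, (c i / norm1On H c) ^ 2 ≤ ∑ i ∈ H, |c i| / norm1On H c := by
        refine Finset.sum_le_sum fun i hi => ?_
        have h1 : |c i| ≤ norm1On H c :=
          Finset.single_le_sum (f := fun i => |c i|) (fun _ _ => abs_nonneg _) hi
        have h2 : |c i| / norm1On H c ≤ 1 := div_le_one_of_le₀ h1 hZ
        have h3 : 0 ≤ |c i| / norm1On H c := by positivity
        rw [← sq_abs, abs_div, abs_of_nonneg hZ]
        nlinarith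
    _ = norm1On H c / norm1On H c := by rw [← Finset.sum_div]; rfl
    _ ≤ 1 := div_self_le_one _

lemma IsPartialSolve.abs_sub_le {L : Matrix (Fin n) (Fin n) ℝ}
    {C : Finset (Finset (Fin n) × Finset (Fin n))} {S : Finset (Fin n)} {c : Fin n → ℝ}
    {εL : ℝ} {xhat : Fin n → ℝ} (hs : IsPartialSolve L C S c εL xhat) (hε : 0 ≤ εL)
    {i : Fin n} (hi : i ∈ S) :
    |xhat i - extSolve L (activeSet C S c) c i| ≤ εL / 2 * norm1On S c := by
  obtain ⟨⟨y, hy, hxy⟩, hx0⟩ := hs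
  have hβ : 0 ≤ norm1On S c := Finset.sum_nonneg fun _ _ => abs_nonneg _
  by_cases hH : i ∈ activeSet C S c
  · set H := activeSet C S c
    set Z := norm1On H c with hZdef
    have hZ : 0 ≤ Z := Finset.sum_nonneg fun _ _ => abs_nonneg _
    have hZS : Z ≤ norm1On S c := Finset.sum_le_sum_of_subset_of_nonneg (activeSet_subset C S c)
      fun _ _ _ => abs_nonneg _
    -- This also holds for Z = 0: then c vanishes on H.
    have hscale : (fun j : H => c j) = Z • fun j : H => c j / Z := by
      ext j
      have h1 : |c j| ≤ Z :=
        Finset.single_le_sum (f := fun i => |c i|) (fun _ _ => abs_nonneg _) j.2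
      rcases hZ.eq_or_lt with h0 | h0
      · rw [← h0] at h1
        simp [abs_nonpos_iff.1 h1]
      · simp only [Pi.smul_apply, smul_eq_mul]
        field_simp
    have h2 := extSolve_coe L H c ⟨i, hH⟩
    rw [hscale, Matrix.mulVec_smul] at h2
    have h3 := hxy ⟨i, hH⟩
    simp only [Pi.smul_apply, smul_eq_mul] at h2 h3
    rw [h2, h3, ← mul_sub, abs_mul, abs_of_nonneg hZ]
    have h4 := (abs_le_norm2 _ ⟨i, hH⟩).trans (hy.trans
      (mul_le_of_le_one_right (by positivity) (norm2_normalized_le_one H c)))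
    rw [Pi.sub_apply] at h4
    calc _ ≤ Z * (εL / 2) := mul_le_mul_of_nonneg_left h4 hZ
      _ ≤ norm1On S c * (εL / 2) := by gcongr
      _ = _ := mul_comm _ _
  · rw [hx0 i (by simp [hi, hH]), extSolve_of_notMem hH]
    simp only [sub_zero, abs_zero]
    positivity

/-! ### Calculus of entrywise approximation and thresholds -/

lemma EntrywiseApprox.trans {η δ : ℝ} {S : Finset (Fin n)} {x y z : Fin n → ℝ}
    (h1 : EntrywiseApprox η S x y) (h2 : EntrywiseApprox δ S y z) :
    EntrywiseApprox (η + δ) S x z := by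
  intro i hi
  obtain ⟨a, b⟩ := h1 i hi
  obtain ⟨c, d⟩ := h2 i hi
  rw [neg_add, Real.exp_add, Real.exp_add, mul_assoc, mul_assoc]
  exact ⟨(mul_le_mul_of_nonneg_left c (Real.exp_pos _).le).trans a,
    b.trans (mul_le_mul_of_nonneg_left d (Real.exp_pos _).le)⟩

lemma EntrywiseApprox.mono {η δ : ℝ} {S : Finset (Fin n)} {x y : Fin n → ℝ}
    (h1 : EntrywiseApprox η S x y) (hηδ : η ≤ δ) (hy : ∀ i ∈ S, 0 ≤ y i) :
    EntrywiseApprox δ S x y := by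
  intro i hi
  obtain ⟨a, b⟩ := h1 i hi
  have := hy i hi
  exact ⟨le_trans (by gcongr) a, b.trans (by gcongr)⟩

/-- Eliminating approximately known variables gives an approximate right-hand side. -/
lemma EntrywiseApprox.rhs {L : Matrix (Fin n) (Fin n) ℝ} (h : IsSDDM L) {b : Fin n → ℝ}
    (hb : ∀ i, 0 ≤ b i) {δ : ℝ} (hδ : 0 ≤ δ) {S : Finset (Fin n)} {x y : Fin n → ℝ}
    (hxy : EntrywiseApprox δ (univ \ S) x y) :
    EntrywiseApprox δ S (fun i => b i - ∑ j ∈ univ \ S, L i j * x j)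
      (fun i => b i - ∑ j ∈ univ \ S, L i j * y j) := by
  intro i hi
  have hL : ∀ j ∈ univ \ S, L i j ≤ 0 := fun j hj =>
    h.offDiag_nonpos i j (by rintro rfl; simp [hi] at hj)
  have e1 : Real.exp (-δ) ≤ 1 := Real.exp_le_one_iff.2 (by linarith)
  have e2 : 1 ≤ Real.exp δ := Real.one_le_exp hδ
  have hbi := hb i
  simp only [mul_sub, Finset.mul_sum]
  have s1 : ∑ j ∈ univ \ S, L i j * x j ≤ ∑ j ∈ univ \ S, Real.exp (-δ) * (L i j * y j) := by
    refine Finset.sum_le_sum fun j hj => ?_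
    have := mul_le_mul_of_nonpos_left (hxy j hj).1 (hL j hj)
    linarith
  have s2 : ∑ j ∈ univ \ S, Real.exp δ * (L i j * y j) ≤ ∑ j ∈ univ \ S, L i j * x j := by
    refine Finset.sum_le_sum fun j hj => ?_
    have := mul_le_mul_of_nonpos_left (hxy j hj).2 (hL j hj)
    linarith
  constructor <;> nlinarith

lemma mulVec_restrict {L : Matrix (Fin n) (Fin n) ℝ} {b x : Fin n → ℝ} (hx : L.mulVec x = b)
    (S : Finset (Fin n)) (i : Fin n) :
    L.mulVec (fun j => if j ∈ S then x j else 0) i = b i - ∑ j ∈ univ \ S, L i j * x j := by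
  rw [← hx]
  simp only [Matrix.mulVec, dotProduct, mul_ite, mul_zero, Finset.sum_ite_mem, univ_inter]
  rw [← Finset.sum_sdiff (subset_univ S)]
  ring

/-- The right-hand side determines the solution entrywise. -/
lemma EntrywiseApprox.extSolve {L : Matrix (Fin n) (Fin n) ℝ} {U : ℝ}
    (hI : HasIntEntries L U) (h : IsSDDM L) (hirr : IsIrred L) {b x : Fin n → ℝ}
    (hx : L.mulVec x = b) {δ : ℝ} {S : Finset (Fin n)} {c : Fin n → ℝ}
    (hc : EntrywiseApprox δ S c (fun i => b i - ∑ j ∈ univ \ S, L i j * x j)) :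
    EntrywiseApprox δ S (extSolve L S c) x := by
  have key : ∀ i, Real.exp (-δ) * (if i ∈ S then x i else 0) ≤ SDDM.extSolve L S c i ∧
      SDDM.extSolve L S c i ≤ Real.exp δ * (if i ∈ S then x i else 0) := by
    intro i
    constructor
    · refine le_of_mulVec_le hI h hirr S
        (Real.exp (-δ) • fun i => if i ∈ S then x i else 0) _ (fun i hi => ?_) (fun i hi => ?_) i
      · rw [Matrix.mulVec_smul, Pi.smul_apply, mulVec_restrict hx,
          mulVec_extSolve hI h hirr S c hi]
        exact (hc i hi).1
      · simp [extSolve_of_notMem hi, hi]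
    · refine le_of_mulVec_le hI h hirr S _
        (Real.exp δ • fun i => if i ∈ S then x i else 0) (fun i hi => ?_) (fun i hi => ?_) i
      · rw [Matrix.mulVec_smul, Pi.smul_apply, mulVec_restrict hx,
          mulVec_extSolve hI h hirr S c hi]
        exact (hc i hi).2
      · simp [extSolve_of_notMem hi, hi]
  intro i hi
  simpa [hi] using key i

lemma IsThreshold.le_two_mul {q θ : ℝ} (h : IsThreshold q θ) (hq : 0 < q) : θ ≤ 2 * q := by
  obtain ⟨⟨k, rfl⟩, -, hmin⟩ := h
  by_contra! hlt
  -- If θ exceeded 2q, then θ/2 would be a smaller power of two above q.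
  have h1 := hmin hq (k - 1) (by
    rw [zpow_sub₀ two_ne_zero, zpow_one]; linarith)
  have h2 : (2 : ℝ) ^ (k - 1) < 2 ^ k := zpow_lt_zpow_right₀ one_lt_two (by omega)
  linarith

end SDDM

namespace SDDM

variable {n : ℕ}

lemma exp_le_of_le_quarter {η : ℝ} (h : η ≤ 1 / 4) : Real.exp η ≤ 1.285 := by
  have h1 : Real.exp (1 / 4) ≤ 1.285 := by
    -- Compare fourth powers: e < 2.7183 < 1.285⁴.
    refine le_of_pow_le_pow_left₀ (n := 4) (by norm_num) (by norm_num) ?_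
    rw [← Real.exp_nat_mul]
    norm_num
    have := Real.exp_one_lt_d9
    norm_num at this
    linarith
  exact (Real.exp_le_exp.2 h).trans h1

lemma le_of_exp_neg_mul_le {η x y : ℝ} (hη : η ≤ 1 / 4) (hx : 0 ≤ x)
    (h : Real.exp (-η) * y ≤ x) : y ≤ 1.285 * x := by
  rw [Real.exp_neg, inv_mul_le_iff₀ (Real.exp_pos _)] at h
  exact h.trans (mul_le_mul_of_nonneg_right (exp_le_of_le_quarter hη) hx)

/-- An additive error that is small compared with `x` is a multiplicative error. -/
lemma exp_approx_of_abs_sub_le {a x y θ : ℝ} (ha : 0 ≤ a) (ha2 : a ≤ 1 / 2) (hθ : 0 ≤ θ)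
    (hx : θ ≤ x) (h : |x - y| ≤ a * θ) :
    Real.exp (-(2 * a)) * y ≤ x ∧ x ≤ Real.exp (2 * a) * y := by
  obtain ⟨h1, h2⟩ := abs_le.1 h
  have h3 : a * θ ≤ a * x := mul_le_mul_of_nonneg_left hx ha
  have h4 := Real.add_one_le_exp (2 * a)
  have hx0 : 0 ≤ x := hθ.trans hx
  have hax : 0 ≤ a * x := mul_nonneg ha hx0
  constructor
  · rw [Real.exp_neg, inv_mul_le_iff₀ (Real.exp_pos _)]
    nlinarith
  · have h5 : (1 - a) * x ≤ y := by linarith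
    have h6 : 0 ≤ (1 - a) * x := mul_nonneg (by linarith) hx0
    have h7 : (2 * a + 1) * ((1 - a) * x) ≤ Real.exp (2 * a) * y :=
      mul_le_mul h4 h5 h6 (Real.exp_pos _).le
    nlinarith [mul_nonneg hax (by linarith : 0 ≤ 1 - 2 * a)]

/-! ### Accuracy of the computed values along a run -/

/-- The hypotheses on an input of the solver together with a run on it. -/
structure RunOn (L : Matrix (Fin n) (Fin n) ℝ) (b : Fin n → ℝ) (U ε α : ℝ)
    (C : Finset (Finset (Fin n) × Finset (Fin n))) (R : Trace n) : Prop where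
  ten_le : 10 ≤ n
  two_le : 2 ≤ U
  eps_pos : 0 < ε
  eps_lt : ε < 1
  sddm : IsSDDM L
  irred : IsIrred L
  int : HasIntEntries L U
  rhs : HasNonnegIntEntries b U
  cover : IsCover L U (rIn n) (rOut n) α C
  run : IsRun L b U ε C R

namespace RunOn

variable {L : Matrix (Fin n) (Fin n) ℝ} {b : Fin n → ℝ} {U ε α : ℝ}
  {C : Finset (Finset (Fin n) × Finset (Fin n))} {R : Trace n}

lemma ten_le_cast (h : RunOn L b U ε α C R) : (10 : ℝ) ≤ n := by exact_mod_cast h.ten_le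

lemma two_mul_le (h : RunOn L b U ε α C R) : 2 * (n : ℝ) ≤ n * U := by
  nlinarith [h.two_le, h.ten_le_cast]

lemma base_ge (h : RunOn L b U ε α C R) : 20 ≤ n * U := by
  linarith [h.two_mul_le, h.ten_le_cast]

lemma base_pos (h : RunOn L b U ε α C R) : 0 < n * U := by linarith [h.base_ge]

lemma mulVec_sol (h : RunOn L b U ε α C R) : L.mulVec (L⁻¹.mulVec b) = b := h.sddm.mulVec_inv b

lemma b_nonneg (h : RunOn L b U ε α C R) (i : Fin n) : 0 ≤ b i := (h.rhs i).2.1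

lemma sol_nonneg (h : RunOn L b U ε α C R) (i : Fin n) : 0 ≤ L⁻¹.mulVec b i := by
  simp only [Matrix.mulVec, dotProduct]
  exact Finset.sum_nonneg fun j _ =>
    mul_nonneg (inv_nonneg h.int h.sddm h.irred i j) (h.b_nonneg j)

lemma reduced_rhs_nonneg (h : RunOn L b U ε α C R) {S : Finset (Fin n)} {i : Fin n}
    (hi : i ∈ S) : 0 ≤ b i - ∑ j ∈ univ \ S, L i j * L⁻¹.mulVec b j := by
  have : ∑ j ∈ univ \ S, L i j * L⁻¹.mulVec b j ≤ 0 := Finset.sum_nonpos fun j hj =>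
    mul_nonpos_of_nonpos_of_nonneg
      (h.sddm.offDiag_nonpos i j (by rintro rfl; simp [hi] at hj)) (h.sol_nonneg j)
  linarith [h.b_nonneg i]

lemma S_succ_subset (h : RunOn L b U ε α C R) {t : ℕ} (ht : t ≤ n) : R.S (t + 1) ⊆ R.S t := by
  rw [h.run.update_S t ht]
  exact Finset.sdiff_subset

lemma S_subset (h : RunOn L b U ε α C R) {s k : ℕ} (ht : s + k ≤ n + 1) :
    R.S (s + k) ⊆ R.S s := by
  induction k with
  | zero => exact subset_rfl
  | succ k ih => exact (h.S_succ_subset (t := s + k) (by omega)).trans (ih (by omega))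

lemma θ_pos (h : RunOn L b U ε α C R) {t : ℕ} (ht : t ≤ n) : 0 < R.θ t := by
  obtain ⟨⟨k, hk⟩, -⟩ := h.run.threshold t ht
  rw [hk]; positivity

/-- The values computed so far are accurate. -/
def Accurate (L : Matrix (Fin n) (Fin n) ℝ) (b : Fin n → ℝ) (R : Trace n) (t : ℕ) : Prop :=
  EntrywiseApprox (t / (5 * n)) (univ \ R.S t) (R.xtil t) (L⁻¹.mulVec b)

lemma budget_le (h : RunOn L b U ε α C R) {t : ℕ} (ht : t ≤ n) :
    (t : ℝ) / (5 * n) + 1 / (8 * n) ≤ 1 / 4 := by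
  have hn := h.ten_le_cast
  have ht' : (t : ℝ) ≤ n := by exact_mod_cast ht
  rw [div_add_div _ _ (by positivity) (by positivity), div_le_div_iff₀ (by positivity)
    (by norm_num)]
  nlinarith

/-- The error t/(5n) of the values already computed passes unchanged to the exact reduced right-hand
side, as b and -L off the diagonal are nonnegative; computing it adds at most 1/(8n). -/
lemma bhat_approx (h : RunOn L b U ε α C R) {t : ℕ} (ht : t ≤ n) (ha : Accurate L b R t) :
    EntrywiseApprox (t / (5 * n) + 1 / (8 * n)) (R.S t) (R.bhat t)
      (fun i => b i - ∑ j ∈ univ \ R.S t, L i j * L⁻¹.mulVec b j) := by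
  have hn := h.ten_le_cast
  rcases t with _ | s
  · intro i _
    rw [h.run.init_S, h.run.init_bhat]
    have hb := h.b_nonneg i
    have hη : 0 ≤ ((0 : ℕ) : ℝ) / (5 * n) + 1 / (8 * n) := by positivity
    have e1 := Real.exp_le_one_iff.2 (neg_nonpos.2 hη)
    have e2 := Real.one_le_exp hη
    simp only [sdiff_self, Finset.bot_eq_empty, Finset.sum_empty, sub_zero]
    constructor <;> nlinarith
  · have h1 := (h.run.update_bhat s (by omega)).trans
      (EntrywiseApprox.rhs h.sddm h.b_nonneg (by positivity) ha)
    refine h1.mono ?_ (fun i hi => h.reduced_rhs_nonneg hi)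
    have : ε / (8 * n) ≤ 1 / (8 * n) := by
      have := h.eps_lt
      gcongr
    linarith

lemma bhat_nonneg (h : RunOn L b U ε α C R) {t : ℕ} (ht : t ≤ n) (ha : Accurate L b R t)
    {i : Fin n} (hi : i ∈ R.S t) : 0 ≤ R.bhat t i :=
  (mul_nonneg (Real.exp_pos _).le (h.reduced_rhs_nonneg hi)).trans (h.bhat_approx ht ha i hi).1

lemma extSolve_approx (h : RunOn L b U ε α C R) {t : ℕ} (ht : t ≤ n) (ha : Accurate L b R t) :
    EntrywiseApprox (t / (5 * n) + 1 / (8 * n)) (R.S t) (extSolve L (R.S t) (R.bhat t))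
      (L⁻¹.mulVec b) :=
  (h.bhat_approx ht ha).extSolve h.int h.sddm h.irred h.mulVec_sol

lemma eight_le_rOut (h : RunOn L b U ε α C R) : 8 ≤ rOut n := by
  have h1 : 1 < Real.sqrt (Real.logb 2 n) := by
    rw [Real.lt_sqrt (by norm_num), one_pow, Real.lt_logb_iff_rpow_lt (by norm_num)
      (by linarith [h.ten_le_cast])]
    rw [Real.rpow_one]
    linarith [h.ten_le_cast]
  have h2 : 1 < ⌈Real.sqrt (Real.logb 2 n)⌉₊ := Nat.lt_ceil.2 (by simpa using h1)
  calc 8 = 2 ^ 3 := by norm_num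
    _ ≤ 2 ^ (ell n - 2) := Nat.pow_le_pow_right (by norm_num) (by unfold ell; omega)

lemma xhat_error (h : RunOn L b U ε α C R) {t : ℕ} (ht : t ≤ n) (ha : Accurate L b R t)
    {i : Fin n} (hi : i ∈ R.S t) :
    |R.xhat t i - extSolve L (R.S t) (R.bhat t) i| ≤ 1 / (30 * n) * R.θ t := by
  have hn := h.ten_le_cast
  have hB := h.base_ge
  have hB0 := h.base_pos
  have hε := h.eps_pos
  have hnn := fun i hi => h.bhat_nonneg ht ha (i := i) hi
  have h1 := (h.run.solve t ht).abs_sub_le (by positivity) hi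
  have h2 := extSolve_sub_activeSet_le h.int h.sddm h.irred (by linarith) h.cover _ _ hnn i
  have h3 := extSolve_mono_set h.int h.sddm h.irred
    (activeSet_subset C (R.S t) (R.bhat t)) _ hnn i
  have h4 := (h.run.threshold t ht).2.1
  have h2n := h.two_mul_le
  have hθ := h.θ_pos ht
  set β := norm1On (R.S t) (R.bhat t)
  have hβ0 : 0 ≤ β := Finset.sum_nonneg fun _ _ => abs_nonneg _
  set B := n * U
  have hβ : β ≤ 4 * B ^ 2 * R.θ t := by
    rw [one_div, inv_mul_lt_iff₀ (by positivity)] at h4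
    exact h4.le
  -- Solver error: the choice of `εL` cancels the factor 4B² in ‖b̂‖₁ ≤ 4B²θ.
  have e1 : ε / (64 * n * B ^ 2) / 2 * β ≤ 1 / (32 * n) * R.θ t := by
    calc ε / (64 * n * B ^ 2) / 2 * β ≤ 1 / (64 * n * B ^ 2) / 2 * (4 * B ^ 2 * R.θ t) := by
          have := h.eps_lt
          gcongr
      _ = 1 / (32 * n) * R.θ t := by field_simp; norm_num
  -- Error of restricting to H: `rOut n` ≥ 8 leaves 4/B⁴, and B³ ≥ 20³, B ≥ 2n.
  have e2 : B ^ 2 / B ^ rOut n * β ≤ 1 / (4000 * n) * R.θ t := by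
    have h8 : B ^ 8 ≤ B ^ rOut n := pow_le_pow_right₀ (by linarith) h.eight_le_rOut
    calc B ^ 2 / B ^ rOut n * β ≤ B ^ 2 / B ^ 8 * (4 * B ^ 2 * R.θ t) := by gcongr
      _ = 4 / B ^ 4 * R.θ t := by field_simp
      _ ≤ 1 / (4000 * n) * R.θ t := by
          refine mul_le_mul_of_nonneg_right ?_ hθ.le
          rw [div_le_div_iff₀ (by positivity) (by positivity)]
          have : 20 ^ 3 * (2 * (n : ℝ)) ≤ B ^ 3 * B := by gcongr
          nlinarith
  have e3 : 1 / (32 * n) * R.θ t + 1 / (4000 * n) * R.θ t ≤ 1 / (30 * n) * R.θ t := by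
    have : (1 : ℝ) / (32 * n) + 1 / (4000 * n) ≤ 1 / (30 * n) := by
      have e : (1 : ℝ) / (30 * n) - (1 / (32 * n) + 1 / (4000 * n)) =
        (1 / 30 - (1 / 32 + 1 / 4000)) * (1 / n) := by field_simp
      have : (0 : ℝ) ≤ (1 / 30 - (1 / 32 + 1 / 4000)) * (1 / n) :=
        mul_nonneg (by norm_num) (by positivity)
      linarith
    nlinarith
  rw [abs_le] at h1 ⊢
  constructor <;> linarith

/-- Relative errors add up: rounding at the threshold costs 2/(30n) and the right-hand side 1/(8n),
and 1/15 + 1/8 < 1/5. -/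
lemma accurate_succ (h : RunOn L b U ε α C R) {t : ℕ} (ht : t ≤ n) (ha : Accurate L b R t) :
    Accurate L b R (t + 1) := by
  have hn := h.ten_le_cast
  intro j hj
  rw [h.run.update_S t ht] at hj
  by_cases hjS : j ∈ R.S t
  · have hjF : j ∈ R.F t := by
      by_contra hjF
      simp [hjS, hjF] at hj
    rw [h.run.update_xtil_new t ht j hjF]
    rw [h.run.extract t ht, Finset.mem_filter] at hjF
    have h1 : EntrywiseApprox (2 * (1 / (30 * n))) {j} (R.xhat t)
        (extSolve L (R.S t) (R.bhat t)) := by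
      intro i hi
      rw [Finset.mem_singleton] at hi
      subst hi
      refine exp_approx_of_abs_sub_le (by positivity) ?_ (h.θ_pos ht).le hjF.2
        (h.xhat_error ht ha hjS)
      rw [div_le_div_iff₀ (by positivity) (by norm_num)]
      linarith
    have h2 : EntrywiseApprox (t / (5 * n) + 1 / (8 * n)) {j}
        (extSolve L (R.S t) (R.bhat t)) (L⁻¹.mulVec b) := by
      intro i hi
      rw [Finset.mem_singleton] at hi
      subst hi
      exact h.extSolve_approx ht ha i hjS
    refine (h1.trans h2).mono ?_ (fun i _ => h.sol_nonneg i) j (Finset.mem_singleton_self j)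
    have e : ((t + 1 : ℕ) : ℝ) / (5 * n) -
        (2 * (1 / (30 * n)) + (t / (5 * n) + 1 / (8 * n))) =
        (1 / 5 - 1 / 15 - 1 / 8) * (1 / n) := by
      push_cast; field_simp; ring
    have : (0 : ℝ) ≤ (1 / 5 - 1 / 15 - 1 / 8) * (1 / n) :=
      mul_nonneg (by norm_num) (by positivity)
    linarith
  · rw [h.run.update_xtil_old t ht j hjS]
    have hj' : j ∈ univ \ R.S t := by simp [hjS]
    have h1 : EntrywiseApprox ((t : ℝ) / (5 * n)) (univ \ R.S t) (R.xtil t) (L⁻¹.mulVec b) := ha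
    refine h1.mono ?_ (fun i _ => h.sol_nonneg i) j hj'
    push_cast
    gcongr
    linarith

lemma accurate (h : RunOn L b U ε α C R) {t : ℕ} (ht : t ≤ n + 1) : Accurate L b R t := by
  induction t with
  | zero =>
    intro j hj
    rw [h.run.init_S] at hj
    simp at hj
  | succ t ih => exact h.accurate_succ (by omega) (ih (by omega))

/-! ### Geometric decay of the thresholds -/

/-- Entries not yet solved are below the threshold. -/
lemma sol_le_θ (h : RunOn L b U ε α C R) {t : ℕ} (ht : t ≤ n) {u : Fin n}
    (hu : u ∈ R.S (t + 1)) : L⁻¹.mulVec b u ≤ 1.3 * R.θ t := by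
  have hn := h.ten_le_cast
  have ha := h.accurate (t := t) (by omega)
  have huS := h.S_succ_subset ht hu
  have hlt : R.xhat t u < R.θ t := by
    by_contra! hge
    rw [h.run.update_S t ht, h.run.extract t ht] at hu
    simp [huS, hge] at hu
  have h1 := (abs_le.1 (h.xhat_error ht ha huS)).1
  have hθ := h.θ_pos ht
  have h2 : 1 / (30 * n) * R.θ t ≤ 1 / 300 * R.θ t := by
    gcongr
    linarith
  -- The constant is 1.285 · (1 + 1/300) < 1.3.
  have h3 := le_of_exp_neg_mul_le (h.budget_le ht)
    (extSolve_nonneg h.int h.sddm h.irred _ _ (fun i hi => h.bhat_nonneg ht ha hi) u)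
    (h.extSolve_approx ht ha u huS).1
  linarith

lemma diag_le (h : RunOn L b U ε α C R) (i : Fin n) : L i i ≤ U :=
  (le_abs_self _).trans (h.int i i).2

/-- The left side is row i of L applied to x cut off outside S, where only the diagonal term can be
positive. -/
lemma reduced_rhs_le (h : RunOn L b U ε α C R) {S : Finset (Fin n)} {i : Fin n} (hi : i ∈ S) :
    b i - ∑ j ∈ univ \ S, L i j * L⁻¹.mulVec b j ≤ U * L⁻¹.mulVec b i := by
  have h1 := mulVec_restrict h.mulVec_sol S i
  rw [← h1]
  simp only [Matrix.mulVec, dotProduct]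
  rw [← Finset.add_sum_erase _ _ (mem_univ i)]
  have h2 : ∑ j ∈ univ.erase i, L i j * (if j ∈ S then L⁻¹.mulVec b j else 0) ≤ 0 :=
    Finset.sum_nonpos fun j hj => mul_nonpos_of_nonpos_of_nonneg
      (h.sddm.offDiag_nonpos i j (Finset.ne_of_mem_erase hj).symm)
      (by split_ifs; exacts [h.sol_nonneg j, le_rfl])
  have h3 := mul_le_mul_of_nonneg_right (h.diag_le i) (h.sol_nonneg i)
  simp only [Matrix.mulVec, dotProduct] at h2 h3
  simp only [if_pos hi]
  linarith

lemma θ_succ_mul_le (h : RunOn L b U ε α C R) {t : ℕ} (ht : t + 1 ≤ n)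
    (hβ : 0 < norm1On (R.S (t + 1)) (R.bhat (t + 1))) :
    R.θ (t + 1) * (n * U) ≤ R.θ t := by
  have ha := h.accurate (t := t + 1) (by omega)
  have hU := h.two_le
  have hB0 := h.base_pos
  have hθ := h.θ_pos (t := t) (by omega)
  have hi : ∀ i ∈ R.S (t + 1), |R.bhat (t + 1) i| ≤ 2 * U * R.θ t := by
    intro i hi
    rw [abs_of_nonneg (h.bhat_nonneg ht ha hi)]
    have h1 := (h.bhat_approx ht ha i hi).2
    have h2 := h.reduced_rhs_le hi
    have h3 := h.sol_le_θ (by omega) hi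
    have h4 := exp_le_of_le_quarter (h.budget_le ht)
    have h5 := mul_le_mul h4 h2 (h.reduced_rhs_nonneg hi) (by norm_num)
    have h6 : U * L⁻¹.mulVec b i ≤ U * (1.3 * R.θ t) := by gcongr
    have h7 : 0 < U * R.θ t := by positivity
    linarith
  have hsum : norm1On (R.S (t + 1)) (R.bhat (t + 1)) ≤ n * (2 * U * R.θ t) := by
    have h1 := Finset.sum_le_card_nsmul _ _ _ hi
    rw [nsmul_eq_mul] at h1
    refine h1.trans (mul_le_mul_of_nonneg_right ?_ (by positivity))
    exact_mod_cast (Finset.card_le_univ _).trans (Fintype.card_fin n).le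
  have h2 := (h.run.threshold (t + 1) ht).le_two_mul (by positivity)
  -- Rounding to a power of two loses 2, and the entry bound 2Uθ_t (as 1.285 · 1.3 < 2) loses
  -- another 2; the 4 in the threshold absorbs both exactly.
  calc R.θ (t + 1) * (n * U)
      ≤ 2 * (1 / (4 * (n * U) ^ 2) * (n * (2 * U * R.θ t))) * (n * U) := by
        refine mul_le_mul_of_nonneg_right (h2.trans ?_) hB0.le
        gcongr
    _ = R.θ t := by
        have : (n : ℝ) ≠ 0 := by linarith [h.ten_le_cast]
        field_simp
        norm_num

/-- Excludes a zero right-hand side, for which the threshold is arbitrary and need not decay: the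
solution on S would vanish, yet it approximates a positive entry. -/
lemma norm1On_pos (h : RunOn L b U ε α C R) {t : ℕ} (ht : t ≤ n) {u : Fin n} (hu : u ∈ R.S t)
    (hx : 0 < L⁻¹.mulVec b u) : 0 < norm1On (R.S t) (R.bhat t) := by
  refine lt_of_le_of_ne (Finset.sum_nonneg fun _ _ => abs_nonneg _) fun h0 => ?_
  have hz : ∀ i ∈ R.S t, R.bhat t i = 0 := fun i hi =>
    abs_eq_zero.1 ((Finset.sum_eq_zero_iff_of_nonneg fun _ _ => abs_nonneg _).1 h0.symm i hi)
  have h1 := nonpos_of_mulVec_nonpos h.int h.sddm h.irred (R.S t)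
    (extSolve L (R.S t) (R.bhat t))
    (fun i hi => by rw [mulVec_extSolve h.int h.sddm h.irred _ _ hi, hz i hi])
    (fun i hi => (extSolve_of_notMem hi).le) u
  have h2 := (h.extSolve_approx ht (h.accurate (by omega)) u hu).1
  have := mul_pos (Real.exp_pos (-((t : ℝ) / (5 * n) + 1 / (8 * n)))) hx
  linarith

lemma θ_add_mul_pow_le (h : RunOn L b U ε α C R) {s k : ℕ} (ht : s + k ≤ n) {u : Fin n}
    (hu : u ∈ R.S (s + k)) (hx : 0 < L⁻¹.mulVec b u) :
    R.θ (s + k) * (n * U) ^ k ≤ R.θ s := by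
  induction k with
  | zero => simp
  | succ k ih =>
    have h1 := h.θ_succ_mul_le (t := s + k) (by omega) (h.norm1On_pos (by omega) hu hx)
    have h2 := ih (by omega) (h.S_succ_subset (t := s + k) (by omega) hu)
    have hB0 := h.base_pos
    calc R.θ (s + (k + 1)) * (n * U) ^ (k + 1)
        = R.θ (s + k + 1) * (n * U) * (n * U) ^ k := by rw [pow_succ]; ring_nf
      _ ≤ R.θ (s + k) * (n * U) ^ k := by gcongr
      _ ≤ R.θ s := h2

/-! ### The first activation of a vertex -/

lemma b_le_mul_sol (h : RunOn L b U ε α C R) (v : Fin n) : b v ≤ U * L⁻¹.mulVec b v := by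
  simpa using h.reduced_rhs_le (mem_univ v)

/-- Row v of Lx = b: the diagonal term must balance b_v ≥ 0 and the term of w, whose coefficient is
at most -1 by integrality. -/
lemma sol_le_mul_sol_of_adj (h : RunOn L b U ε α C R) {v w : Fin n} (hvw : v ≠ w)
    (hL : L v w ≠ 0) : L⁻¹.mulVec b w ≤ U * L⁻¹.mulVec b v := by
  have h1 := h.reduced_rhs_le (S := {v}) (Finset.mem_singleton_self v)
  have h2 : ∑ j ∈ univ \ {v}, L v j * L⁻¹.mulVec b j ≤ L v w * L⁻¹.mulVec b w := by
    have hneg : ∀ j ∈ univ \ {v}, 0 ≤ -(L v j * L⁻¹.mulVec b j) := by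
      intro j hj
      have hj' : v ≠ j := by
        rintro rfl
        simp at hj
      have := mul_nonpos_of_nonpos_of_nonneg (h.sddm.offDiag_nonpos v j hj') (h.sol_nonneg j)
      linarith
    have := Finset.single_le_sum hneg (by simpa using hvw.symm : w ∈ univ \ {v})
    rw [Finset.sum_neg_distrib] at this
    linarith
  have h3 := h.int.le_neg_one h.sddm hvw hL
  have h4 := mul_le_mul_of_nonneg_right h3 (h.sol_nonneg w)
  linarith [h.b_nonneg v]

/-- If `bhat v` is positive after iteration `t` but not before, then a neighbour of `v` has been
solved in iteration `t`. -/
lemma exists_solved_neighbor (h : RunOn L b U ε α C R) {t : ℕ} (ht : t + 1 ≤ n) {v : Fin n}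
    (hv : v ∈ R.S (t + 1)) (hpos : 0 < R.bhat (t + 1) v) (hnp : R.bhat t v ≤ 0) :
    ∃ w ∈ R.F t, v ≠ w ∧ L v w ≠ 0 := by
  have hvS := h.S_succ_subset (t := t) (by omega) hv
  by_contra! hcon
  -- A multiplicative approximation preserves signs, so the exact expressions change from
  -- nonpositive to positive; only an entry solved in iteration t can cause that.
  have hold : b v - ∑ j ∈ univ \ R.S t, L v j * R.xtil t j ≤ 0 := by
    rcases t with _ | s
    · rw [h.run.init_bhat] at hnp
      simpa [h.run.init_S] using hnp
    · have h1 := (h.run.update_bhat s (by omega) v hvS).1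
      exact nonpos_of_mul_nonpos_right (h1.trans hnp) (Real.exp_pos _)
  have hnew : 0 < b v - ∑ j ∈ univ \ R.S (t + 1), L v j * R.xtil (t + 1) j := by
    have h1 := (h.run.update_bhat t (by omega) v hv).2
    exact (mul_pos_iff_of_pos_left (Real.exp_pos _)).1 (hpos.trans_le h1)
  have hsub : univ \ R.S t ⊆ univ \ R.S (t + 1) :=
    Finset.sdiff_subset_sdiff subset_rfl (h.S_succ_subset (by omega))
  have heq : ∑ j ∈ univ \ R.S (t + 1), L v j * R.xtil (t + 1) j =
      ∑ j ∈ univ \ R.S t, L v j * R.xtil t j := by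
    rw [← Finset.sum_subset hsub (f := fun j => L v j * R.xtil (t + 1) j)]
    · refine Finset.sum_congr rfl fun j hj => ?_
      rw [h.run.update_xtil_old t (by omega) j (by simpa using hj)]
    · intro j hj hj'
      have hjF : j ∈ R.F t := by
        rw [h.run.update_S t (by omega)] at hj
        simp at hj hj'
        exact hj hj'
      rw [hcon j hjF (by
        rintro rfl
        simp [hv] at hj), zero_mul]
  rw [heq] at hnew
  linarith

lemma θ_le_mul_sol (h : RunOn L b U ε α C R) {t : ℕ} (ht : t ≤ n) {w : Fin n}
    (hw : w ∈ R.F t) : R.θ t ≤ 1.285 * L⁻¹.mulVec b w := by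
  have hn := h.ten_le_cast
  have hwF := hw
  rw [h.run.extract t ht, Finset.mem_filter] at hwF
  have h1 := h.accurate (t := t + 1) (by omega) w (by
    rw [h.run.update_S t ht]
    simp [hw])
  rw [h.run.update_xtil_new t ht w hw] at h1
  have h2 : ((t + 1 : ℕ) : ℝ) / (5 * n) ≤ 1 / 4 := by
    have ht' : (t : ℝ) ≤ n := by exact_mod_cast ht
    rw [div_le_div_iff₀ (by positivity) (by norm_num)]
    push_cast
    linarith
  exact hwF.2.trans (h1.2.trans
    (mul_le_mul_of_nonneg_right (exp_le_of_le_quarter h2) (h.sol_nonneg w)))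

/-- When `u` is active for the first time, some `v` close to `u` has a solution entry that is
large compared with the threshold. -/
lemma exists_large_of_first (h : RunOn L b U ε α C R) {t : ℕ} (ht : t ≤ n) {u : Fin n}
    (hu : u ∈ R.H C t) (hfirst : ∀ s < t, u ∉ R.H C s) :
    ∃ v, probDist L U u v ≤ rIn n ∧ R.θ t * (n * U) ≤ 1.285 * (U * L⁻¹.mulVec b v) := by
  obtain ⟨huS, p, hp, hup, v, hvp, hvS, hv⟩ := mem_activeSet.1 hu
  refine ⟨v, h.cover.diam p hp u (h.cover.inner_subset p hp hup) v hvp, ?_⟩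
  have hβ : 0 < norm1On (R.S t) (R.bhat t) :=
    lt_of_lt_of_le (abs_pos.2 hv.ne') (Finset.single_le_sum (f := fun i => |R.bhat t i|)
      (fun _ _ => abs_nonneg _) hvS)
  have hB0 := h.base_pos
  rcases t with _ | s
  · rw [h.run.init_bhat] at hv
    have hv1 : 1 ≤ b v := by
      obtain ⟨⟨z, hz⟩, -⟩ := h.rhs v
      rw [hz] at hv ⊢
      have : 0 < z := by exact_mod_cast hv
      exact_mod_cast this
    have h1 := (h.run.threshold 0 ht).le_two_mul (by positivity)
    have h2 : norm1On (R.S 0) (R.bhat 0) ≤ n * U := by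
      rw [h.run.init_S, h.run.init_bhat, norm1On]
      have := Finset.sum_le_card_nsmul univ (fun i => |b i|) U
        (fun i _ => by rw [abs_of_nonneg (h.b_nonneg i)]; exact (h.rhs i).2.2)
      simpa using this
    -- In iteration 0 this suffices, as 1 ≤ b_v ≤ U x_v.
    have h3 : R.θ 0 * (n * U) ≤ 1 / 2 := by
      calc R.θ 0 * (n * U) ≤ 2 * (1 / (4 * (n * U) ^ 2) * (n * U)) * (n * U) := by
            refine mul_le_mul_of_nonneg_right (h1.trans ?_) hB0.le
            gcongr
        _ = 1 / 2 := by
            have := hB0.ne'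
            generalize n * U = B at *
            field_simp
            norm_num
    have h4 := h.b_le_mul_sol v
    linarith
  · have hnp : R.bhat s v ≤ 0 := by
      by_contra! hcon
      exact hfirst s (by omega) (mem_activeSet.2
        ⟨h.S_succ_subset (by omega) huS, p, hp, hup, v, hvp,
          h.S_succ_subset (by omega) hvS, hcon⟩)
    obtain ⟨w, hw, hvw, hL⟩ := h.exists_solved_neighbor ht hvS hv hnp
    have h1 := h.θ_succ_mul_le ht hβ
    have h2 := h.θ_le_mul_sol (by omega) hw
    have h3 := h.sol_le_mul_sol_of_adj hvw hL
    linarith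

lemma solved_after_first (h : RunOn L b U ε α C R) {t : ℕ} {u : Fin n}
    (hu : u ∈ R.H C t) (hfirst : ∀ s < t, u ∉ R.H C s) (ht : t + rIn n ≤ n) :
    u ∉ R.S (t + rIn n) := by
  intro huS
  obtain ⟨v, hD, hv⟩ := h.exists_large_of_first (by omega) hu hfirst
  have hB0 := h.base_pos
  have hU := h.two_le
  have hn := h.ten_le_cast
  have hθ := h.θ_pos (t := t) (by omega)
  have h1 := sq_le_inv_mul_pow (by linarith [h.base_ge]) (inv_pos h.int h.sddm h.irred u v) hD
  have h2 := hitting_le h.int h.sddm h.irred (L⁻¹.mulVec b)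
    (fun i => by rw [h.mulVec_sol]; exact h.b_nonneg i) u v
  have h3 := inv_diag_le h.int h.sddm h.irred v
  have hxu := h.sol_nonneg u
  have hxv := h.sol_nonneg v
  -- Being unsolved at time t + k + 1 is a bound in terms of θ_{t+k}, so only k steps of decay are
  -- available; the missing factor B is the one gained in `exists_large_of_first`.
  obtain ⟨k, hk⟩ : ∃ k, rIn n = k + 1 :=
    Nat.exists_eq_succ_of_ne_zero (by unfold rIn; positivity)
  rw [hk] at h1 huS ht
  set xu := L⁻¹.mulVec b u
  set xv := L⁻¹.mulVec b v
  set g := L⁻¹ u v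
  have h4 : U ^ 2 * xv ≤ xu * (n * U) ^ (k + 1) := by
    have e1 : xv * (n * U) ^ 2 ≤ xv * (g * (n * U) ^ (k + 1)) :=
      mul_le_mul_of_nonneg_left h1 hxv
    have e2 : xv * g * (n * U) ^ (k + 1) ≤ xu * (n : ℝ) ^ 2 * (n * U) ^ (k + 1) :=
      mul_le_mul_of_nonneg_right (h2.trans (mul_le_mul_of_nonneg_left h3 hxu)) (by positivity)
    have e3 : (n : ℝ) ^ 2 * (U ^ 2 * xv) ≤ (n : ℝ) ^ 2 * (xu * (n * U) ^ (k + 1)) := by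
      calc _ = xv * (n * U) ^ 2 := by ring
        _ ≤ _ := e1
        _ = xv * g * (n * U) ^ (k + 1) := by ring
        _ ≤ _ := e2
        _ = _ := by ring
    exact le_of_mul_le_mul_left e3 (by positivity)
  have hθB : 0 < R.θ t * (n * U) := by positivity
  have hUxv : 0 < U * xv := by linarith
  -- Here U ≥ 2 is used; the final contradiction is 1.3 · 1.285 < 2.
  have h5 : 2 * (U * xv) ≤ xu * (n * U) ^ (k + 1) := by nlinarith
  have hxu0 : 0 < xu := by
    refine lt_of_le_of_ne hxu fun h0 => ?_
    rw [← h0, zero_mul] at h5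
    linarith
  have h6 := h.θ_add_mul_pow_le (s := t) (k := k) (by omega)
    (h.S_succ_subset (t := t + k) (by omega) huS) hxu0
  have h7 := h.sol_le_θ (t := t + k) (by omega) huS
  have h8 : xu * (n * U) ^ (k + 1) ≤ 1.3 * (R.θ t * (n * U)) := by
    calc xu * (n * U) ^ (k + 1) ≤ 1.3 * R.θ (t + k) * (n * U) ^ (k + 1) := by gcongr
      _ = 1.3 * (R.θ (t + k) * (n * U) ^ k * (n * U)) := by rw [pow_succ]; ring
      _ ≤ _ := by gcongr
  linarith

/-! ### Counting active iterations -/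

lemma sum_mem_H_le (h : RunOn L b U ε α C R) (u : Fin n) :
    ∑ t ∈ Finset.range (n + 1), (if u ∈ R.H C t then 1 else 0) ≤ rIn n := by
  classical
  rw [← Finset.card_filter]
  by_cases hex : ∃ t, u ∈ R.H C t
  · set t₀ := Nat.find hex with ht₀
    have hfirst : ∀ s < t₀, u ∉ R.H C s := fun s hs => Nat.find_min hex hs
    have hsub : (Finset.range (n + 1)).filter (fun t => u ∈ R.H C t) ⊆
        Finset.Ico t₀ (t₀ + rIn n) := by
      intro t ht
      rw [Finset.mem_filter, Finset.mem_range] at ht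
      rw [Finset.mem_Ico]
      refine ⟨Nat.find_min' hex ht.2, ?_⟩
      by_contra! hge
      obtain ⟨k, rfl⟩ := Nat.exists_eq_add_of_le hge
      exact h.solved_after_first (Nat.find_spec hex) hfirst (by omega)
        (h.S_subset (by omega) (mem_activeSet.1 ht.2).1)
    simpa using Finset.card_le_card hsub
  · push Not at hex
    simp [hex]

/-- With s = √(log₂ n) ≥ 1, the exponent 2ℓ + 1 is at most 2(s + 4) + 1 ≤ 11s. -/
lemma rIn_le (h : RunOn L b U ε α C R) :
    (rIn n : ℝ) ≤ (2 : ℝ) ^ (11 * Real.sqrt (Real.logb 2 n)) := by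
  have h1 : 1 ≤ Real.sqrt (Real.logb 2 n) := by
    rw [Real.one_le_sqrt, Real.le_logb_iff_rpow_le (by norm_num)
      (by linarith [h.ten_le_cast])]
    rw [Real.rpow_one]
    linarith [h.ten_le_cast]
  have h2 := Nat.ceil_lt_add_one (Real.sqrt_nonneg (Real.logb 2 n))
  rw [rIn, Nat.cast_pow, ← Real.rpow_natCast]
  push_cast [ell]
  exact Real.rpow_le_rpow_of_exponent_le (by norm_num) (by linarith)

/-- Double counting of the pairs (t, u) with u active at t. -/
lemma sum_card_H_le (h : RunOn L b U ε α C R) :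
    ∑ t ∈ Finset.range (n + 1), (R.H C t).card ≤ n * rIn n := by
  have h1 : ∀ t, (R.H C t).card = ∑ u, if u ∈ R.H C t then 1 else 0 := fun t => by simp
  simp_rw [h1]
  rw [Finset.sum_comm]
  simpa using Finset.sum_le_card_nsmul univ _ _ fun u _ => h.sum_mem_H_le u

end RunOn

end SDDM

theorem lemma3p9 :
    ∃ K : ℝ, 0 < K ∧
      ∀ (n : ℕ) (U ε α : ℝ) (L : Matrix (Fin n) (Fin n) ℝ) (b : Fin n → ℝ)
        (C : Finset (Finset (Fin n) × Finset (Fin n))) (R : SDDM.Trace n),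
        10 ≤ n → 2 ≤ U → 0 < ε → ε < 1 →
        SDDM.IsSDDM L → SDDM.IsIrred L → SDDM.HasIntEntries L U →
        SDDM.HasNonnegIntEntries b U →
        SDDM.IsCover L U (SDDM.rIn n) (SDDM.rOut n) α C →
        SDDM.IsRun L b U ε C R →
        (∀ u : Fin n,
          ∑ t ∈ Finset.range (n + 1), (if u ∈ R.H C t then 1 else 0) ≤ SDDM.rIn n) ∧
        ((∑ t ∈ Finset.range (n + 1), (R.H C t).card : ℕ) : ℝ) ≤
          n * (2 : ℝ) ^ (K * Real.sqrt (Real.logb 2 n)) := by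
  refine ⟨11, by norm_num, fun n U ε α L b C R hn hU hε hε' hL hirr hI hb hC hR => ?_⟩
  have h : SDDM.RunOn L b U ε α C R := ⟨hn, hU, hε, hε', hL, hirr, hI, hb, hC, hR⟩
  refine ⟨h.sum_mem_H_le, ?_⟩
  calc ((∑ t ∈ Finset.range (n + 1), (R.H C t).card : ℕ) : ℝ) ≤ (n * SDDM.rIn n : ℕ) :=
        Nat.cast_le.2 h.sum_card_H_le
    _ = n * (SDDM.rIn n : ℝ) := Nat.cast_mul _ _
    _ ≤ _ := mul_le_mul_of_nonneg_left h.rIn_le (Nat.cast_nonneg n)
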